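/- Let $\mathsf{T}$ be a rigidly-compactly generated tensor triangulated category: a compactly generated triangulated category with set-indexed coproducts and a closed symmetric monoidal structure $(\otimes,\mathbf{1})$, such that $\otimes$ is exact and coproduct preserving in each variable, and the compact objects contain $\mathbf 1$, are closed under $\otimes$ and internal hom, and are rigid (the evaluation maps $\hom(a,\mathbf 1)\otimes b\to\hom(a,b)$ are isomorphisms for compact $a,b$). Let $\mathrm{Loc}^\otimes(\mathsf{T})$ be the complete lattice of localizing tensor-ideals of $\mathsf{T}$, ordered by inclusion, and write $\mathrm{loc}^\otimes(\mathcal{M})$ for the smallest localizing tensor-ideal containing $\mathcal{M}$. Let $F$ be a spatial frame with space of points $\mathrm{pt}(F)$ and open sets $U_f=\{p\in \mathrm{pt}(F)\mid p(f)=1\}$ for $f\in F$. Let $\tau\colon F\to \mathrm{Loc}^\otimes(\mathsf{T})$ be an injective map preserving arbitrary joins and finite meets which factors through idempotent algebras: for every $f\in F$ there is an idempotent algebra $A_{\tau f}$, i.e. a morphism $\eta\colon\mathbf{1}\to A_{\tau f}$ such that $A_{\tau f}\otimes\eta$ is an isomorphism, with $\tau(f)=\ker(A_{\tau f}\otimes-)$.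 Let $C_{\tau f}$ be the corresponding idempotent coalgebra, given by a triangle $C_{\tau f}\to\mathbf{1}\to A_{\tau f}\to\Sigma C_{\tau f}$. Suppose that $\mathrm{pt}(F)$ is $T_D$, i.e. every point is locally closed. For $p\in\mathrm{pt}(F)$ choose $f,g\in F$ with $\{p\}=U_f\setminus U_g$ and put $\Gamma_p=C_{\tau f}\otimes A_{\tau g}$. Define \[\upsilon\colon\mathcal{P}(\mathrm{pt}(F))\to\mathrm{Loc}^\otimes(\mathsf{T}),\qquad \upsilon(W)=\mathrm{loc}^\otimes(\Gamma_p\mid p\in W),\] and suppose that the local-to-global principle holds, i.e. $\upsilon(\mathrm{pt}(F))=\mathsf{T}$. For a localizing tensor-ideal $\mathsf{L}$ set \[\mathrm{Supp}\,\mathsf{L}=\{p\in\mathrm{pt}(F)\mid\Gamma_p\otimes\mathsf{L}\neq0\},\] where $\Gamma_p\otimes\mathsf{L}\ne0$ means $\Gamma_p\otimes M\neq 0$ for some $M\in\mathsf{L}$, and for an object $M$ set $\mathrm{Supp}\,M=\mathrm{Supp}\,\mathrm{loc}^\otimes(M)$. Then: \begin{enumerate} \item $\mathrm{Supp}$ is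 left adjoint to $\upsilon$: for every localizing tensor-ideal $\mathsf{L}$ and every $W\subseteq\mathrm{pt}(F)$ one has $\mathrm{Supp}\,\mathsf{L}\subseteq W$ if and only if $\mathsf{L}\subseteq\upsilon(W)$; \item $\mathrm{Supp}$ detects vanishing: for every $M\in\mathsf{T}$, $M=0$ if and only if $\mathrm{Supp}\,M=\varnothing$; \item $\mathrm{Supp}\,\upsilon(W)=W$ for every $W\subseteq\mathrm{pt}(F)$, so $\mathrm{Supp}$ is a retraction onto $\mathcal{P}(\mathrm{pt}(F))$. \end{enumerate} -/

import Mathlib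

open CategoryTheory CategoryTheory.Limits MonoidalCategory Pretriangulated ZeroObject

universe u v w

namespace BigTT



/-! ### Big tt-categories -/

section Setting

variable (T : Type u) [Category.{v} T] [HasZeroObject T] [HasShift T ℤ] [Preadditive T]
  [∀ n : ℤ, (shiftFunctor T n).Additive] [Pretriangulated T] [HasCoproducts.{v} T]

/-- An object `t` is compact if `T(t, -)`, as a functor to abelian groups, preserves all
set-indexed coproducts. -/
def compactObjects : ObjectProperty T := fun t =>
  ∀ J : Type v, PreservesColimitsOfShape (Discrete J) (preadditiveCoyoneda.obj (Opposite.op t))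

/-- `T` is compactly generated: there is a set of compact objects `G i` such that an object `M`
is zero if and only if every morphism from a `G i` to a suspension of `M` vanishes. -/
class IsCompactlyGenerated : Prop where
  exists_generators : ∃ (ι : Type v) (G : ι → T), (∀ i, compactObjects T (G i)) ∧
    ∀ M : T, IsZero M ↔ ∀ (i : ι) (n : ℤ) (φ : G i ⟶ M⟦n⟧), φ = 0

variable [MonoidalCategory T]

/-- The tensor product is, in each variable, an exact functor preserving set-indexed
coproducts. -/
class IsTensorTriangulated : Prop where
  exact_tensorLeft : ∀ X : T, ∃ _ : (tensorLeft X).CommShift ℤ, (tensorLeft X).IsTriangulated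
  exact_tensorRight : ∀ X : T, ∃ _ : (tensorRight X).CommShift ℤ, (tensorRight X).IsTriangulated
  coproducts_tensorLeft : ∀ (X : T) (J : Type v),
    PreservesColimitsOfShape (Discrete J) (tensorLeft X)
  coproducts_tensorRight : ∀ (X : T) (J : Type v),
    PreservesColimitsOfShape (Discrete J) (tensorRight X)

variable {T} in
/-- The natural evaluation map `hom(a, 𝟙) ⊗ b ⟶ hom(a, b)`, adjoint to
`a ⊗ hom(a, 𝟙) ⊗ b ⟶ 𝟙 ⊗ b ≅ b`. -/
noncomputable def evaluationMap [MonoidalClosed T] (a b : T) :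
    (ihom a).obj (𝟙_ T) ⊗ b ⟶ (ihom a).obj b :=
  MonoidalClosed.curry
    ((α_ a ((ihom a).obj (𝟙_ T)) b).inv ≫ (ihom.ev a).app (𝟙_ T) ▷ b ≫ (λ_ b).hom)

/-- A big tt-category: a rigidly-compactly generated tensor triangulated category. The compact
objects contain the unit, are closed under tensor products and internal homs, and form a rigid
category: the evaluation maps `a^∨ ⊗ b ⟶ hom(a, b)` between compact objects are isomorphisms. -/
class IsBigTTCategory [MonoidalClosed T] : Prop extends
    IsCompactlyGenerated T, IsTensorTriangulated T where
  compact_unit : compactObjects T (𝟙_ T)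
  compact_tensor : ∀ a b : T, compactObjects T a → compactObjects T b → compactObjects T (a ⊗ b)
  compact_ihom : ∀ a b : T, compactObjects T a → compactObjects T b →
    compactObjects T ((ihom a).obj b)
  isIso_evaluationMap : ∀ a b : T, compactObjects T a → compactObjects T b →
    IsIso (evaluationMap a b)

/-! ### Localizing tensor-ideals -/

/-- A localizing tensor-ideal: a (replete) full triangulated subcategory which is closed under
set-indexed coproducts and under tensoring with arbitrary objects. -/
@[ext]
structure LocalizingIdeal where
  prop : ObjectProperty T
  isTriangulated : prop.IsTriangulated
  isClosedUnderIsomorphisms : prop.IsClosedUnderIsomorphisms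
  coproduct_mem : ∀ {J : Type v} (X : J → T), (∀ j, prop (X j)) → prop (∐ X)
  tensor_mem : ∀ X M : T, prop M → prop (X ⊗ M)

end Setting

section Ideals

variable {T : Type u} [Category.{v} T] [HasZeroObject T] [HasShift T ℤ] [Preadditive T]
  [∀ n : ℤ, (shiftFunctor T n).Additive] [Pretriangulated T] [HasCoproducts.{v} T]
  [MonoidalCategory T]

namespace LocalizingIdeal

/-- Localizing ideals are ordered by inclusion. -/
instance : PartialOrder (LocalizingIdeal T) :=
  PartialOrder.lift LocalizingIdeal.prop (fun _ _ h => LocalizingIdeal.ext h)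

/-- The intersection of a collection of localizing ideals. -/
instance : InfSet (LocalizingIdeal T) where
  sInf S :=
    { prop := fun M => ∀ L ∈ S, L.prop M
      isTriangulated :=
        { exists_zero := ⟨0, isZero_zero T, fun L _ =>
            haveI := L.isTriangulated
            haveI := L.isClosedUnderIsomorphisms
            L.prop.prop_zero⟩
          isStableUnderShiftBy := fun n => ⟨fun M hM L hL =>
            haveI := L.isTriangulated
            L.prop.le_shift n M (hM L hL)⟩
          toIsTriangulatedClosed₂ :=
            ⟨fun D hD h₁ h₃ => ObjectProperty.le_isoClosure _ _ fun L hL =>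
              haveI := L.isTriangulated
              haveI := L.isClosedUnderIsomorphisms
              L.prop.ext_of_isTriangulatedClosed₂ D hD (h₁ L hL) (h₃ L hL)⟩ }
      isClosedUnderIsomorphisms := ⟨fun e hM L hL =>
        haveI := L.isClosedUnderIsomorphisms
        L.prop.prop_of_iso e (hM L hL)⟩
      coproduct_mem := fun X hX L hL => L.coproduct_mem X fun j => hX j L hL
      tensor_mem := fun X M hM L hL => L.tensor_mem X M (hM L hL) }

/-- The lattice of localizing ideals: meets are intersections, and the join of a family is the
smallest localizing ideal containing all its members. -/
instance : CompleteLattice (LocalizingIdeal T) :=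
  completeLatticeOfInf (LocalizingIdeal T) fun _ =>
    ⟨fun L hL _ hM => hM L hL, fun _ hK M hM _ hL => hK hL M hM⟩

/-- `loc^⊗(𝓜)`, the smallest localizing ideal containing the class of objects `𝓜`. -/
def generate (𝓜 : Set T) : LocalizingIdeal T :=
  sInf {L | ∀ M ∈ 𝓜, L.prop M}

end LocalizingIdeal

end Ideals

section Idempotents

variable (T : Type u) [Category.{v} T] [MonoidalCategory T]

/-- An idempotent algebra: a morphism `η : 𝟙 ⟶ A` such that `A ⊗ η` is an isomorphism. -/
structure IdempotentAlgebra where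
  obj : T
  unit : 𝟙_ T ⟶ obj
  isIso_whiskerLeft : IsIso (obj ◁ unit)

/-- An idempotent coalgebra: a morphism `ε : C ⟶ 𝟙` such that `C ⊗ ε` is an isomorphism. -/
structure IdempotentCoalgebra where
  obj : T
  counit : obj ⟶ 𝟙_ T
  isIso_whiskerLeft : IsIso (obj ◁ counit)

end Idempotents

section Support

variable {T : Type u} [Category.{v} T] [HasZeroObject T] [HasShift T ℤ] [Preadditive T]
  [∀ n : ℤ, (shiftFunctor T n).Additive] [Pretriangulated T] [HasCoproducts.{v} T]
  [MonoidalCategory T] [SymmetricCategory T]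

namespace IdempotentAlgebra

/-- The smashing ideal `ker(A ⊗ -)` corresponding to an idempotent algebra `A`. -/
def ideal [IsTensorTriangulated T] (A : IdempotentAlgebra T) : LocalizingIdeal T where
  prop := fun M => IsZero (A.obj ⊗ M)
  isTriangulated := by
    obtain ⟨_, _⟩ := IsTensorTriangulated.exact_tensorLeft A.obj
    exact
      { exists_zero := ⟨0, isZero_zero T, (tensorLeft A.obj).map_isZero (isZero_zero T)⟩
        isStableUnderShiftBy := fun n => ⟨fun M hM =>
          ((shiftFunctor T n).map_isZero hM).of_iso
            (((tensorLeft A.obj).commShiftIso n).app M)⟩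
        toIsTriangulatedClosed₂ := ⟨fun D hD h₁ h₃ => ObjectProperty.le_isoClosure _ _ <| by
          have hD' := (tensorLeft A.obj).map_distinguished D hD
          have h := (Triangle.isZero₂_iff _ hD').2
            ⟨IsZero.eq_of_src h₁ _ _, IsZero.eq_of_tgt h₃ _ _⟩
          exact h⟩ }
  isClosedUnderIsomorphisms := ⟨fun e h => h.of_iso ((tensorLeft A.obj).mapIso e.symm)⟩
  coproduct_mem := fun {J} X hX => by
    have := IsTensorTriangulated.coproducts_tensorLeft A.obj J
    refine IsZero.of_iso ?_ (PreservesCoproduct.iso (tensorLeft A.obj) X)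
    rw [IsZero.iff_id_eq_zero]
    exact Sigma.hom_ext _ _ fun j => (hX j).eq_of_src _ _
  tensor_mem := fun X M hM => by
    obtain ⟨_, _⟩ := IsTensorTriangulated.exact_tensorLeft X
    exact ((tensorLeft X).map_isZero hM).of_iso
      ((α_ A.obj X M).symm ≪≫ whiskerRightIso (β_ A.obj X) M ≪≫ α_ X A.obj M)

set_option linter.unusedSectionVars false in
/-- The idempotent coalgebra corresponding to an idempotent algebra `A`: there is a distinguished
triangle `C ⟶ 𝟙 ⟶ A ⟶ Σ C` on the counit of `C` and the unit of `A`. -/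
theorem exists_coalgebra [IsTensorTriangulated T] (A : IdempotentAlgebra T) :
    ∃ (C : IdempotentCoalgebra T) (δ : A.obj ⟶ C.obj⟦(1 : ℤ)⟧),
      Triangle.mk C.counit A.unit δ ∈ distTriang T := by
  obtain ⟨Z, ε, δ, hD⟩ := distinguished_cocone_triangle₁ A.unit
  have hAZ : IsZero (A.obj ⊗ Z) := by
    obtain ⟨_, _⟩ := IsTensorTriangulated.exact_tensorLeft A.obj
    have hD' := (tensorLeft A.obj).map_distinguished _ hD
    exact Triangle.isZero₁_of_isIso₂ _ hD' A.isIso_whiskerLeft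
  have hZA : IsZero (Z ⊗ A.obj) := hAZ.of_iso (β_ Z A.obj)
  have hε : IsIso (Z ◁ ε) := by
    obtain ⟨_, _⟩ := IsTensorTriangulated.exact_tensorLeft Z
    have hD' := (tensorLeft Z).map_distinguished _ hD
    exact (Triangle.isZero₃_iff_isIso₁ _ hD').1 hZA
  exact ⟨⟨Z, ε, hε⟩, δ, hD⟩

/-- The idempotent coalgebra `C` in the triangle `C ⟶ 𝟙 ⟶ A ⟶ Σ C`. -/
noncomputable def coalgebra [IsTensorTriangulated T] (A : IdempotentAlgebra T) :
    IdempotentCoalgebra T :=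
  A.exists_coalgebra.choose

end IdempotentAlgebra

/-! ### Categorified spatial frames and refined supports -/

/-- A frame is spatial if it is isomorphic to the frame of open subsets of a space. -/
def IsSpatial (F : Type w) [Order.Frame F] : Prop :=
  ∃ (X : Type w) (_ : TopologicalSpace X), Nonempty (F ≃o TopologicalSpace.Opens X)

/-- A topological space is `T_D` if every point is locally closed. -/
def IsTD (X : Type w) [TopologicalSpace X] : Prop :=
  ∀ x : X, IsLocallyClosed ({x} : Set X)

/-- The open set `U_f` of points of `F` determined by `f`. -/
def openOf {F : Type w} [Order.Frame F] (f : F) : Set (Locale.PT F) :=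
  {p | p f}

/-- In a `T_D` frame every point can be cut out as `{p} = U_f ∩ V_g`, with `V_g` the complement
of `U_g`. -/
theorem exists_presentation {F : Type w} [Order.Frame F] (hD : IsTD (Locale.PT F))
    (p : Locale.PT F) : ∃ fg : F × F, {p} = openOf fg.1 ∩ (openOf fg.2)ᶜ := by
  obtain ⟨U, Z, hU, hZ, h⟩ := hD p
  obtain ⟨f, hf⟩ := (Locale.PT.isOpen_iff F U).1 hU
  obtain ⟨g, hg⟩ := (Locale.PT.isOpen_iff F Zᶜ).1 hZ.isOpen_compl
  refine ⟨(f, g), ?_⟩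
  have hf' : openOf f = U := hf
  have hg' : openOf g = Zᶜ := hg
  rw [hf', hg', compl_compl, h]

variable [IsTensorTriangulated T] {F : Type w} [Order.Frame F]

/-- A map of complete lattices `τ : F ⟶ Loc^⊗(T)` factors through `Idem(T)` if each `τ f` is the
smashing ideal of an idempotent algebra. -/
def FactorsThroughIdem (τ : FrameHom F (LocalizingIdeal T)) : Prop :=
  ∀ f : F, ∃ A : IdempotentAlgebra T, A.ideal = τ f

variable {τ : FrameHom F (LocalizingIdeal T)}

/-- The idempotent algebra `A_{τ f}`. -/
noncomputable def algebraAt (hτ : FactorsThroughIdem τ) (f : F) : IdempotentAlgebra T :=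
  (hτ f).choose

/-- The idempotent coalgebra `C_{τ f}`. -/
noncomputable def coalgebraAt (hτ : FactorsThroughIdem τ) (f : F) : IdempotentCoalgebra T :=
  (algebraAt hτ f).coalgebra

/-- The idempotent `Γ_p = C_{τ f} ⊗ A_{τ g}` at a point `p`, for a chosen pair `f, g` with
`{p} = U_f ∩ V_g`. -/
noncomputable def Γ (hτ : FactorsThroughIdem τ) (hD : IsTD (Locale.PT F)) (p : Locale.PT F) : T :=
  (coalgebraAt hτ (exists_presentation hD p).choose.1).obj ⊗
    (algebraAt hτ (exists_presentation hD p).choose.2).obj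

/-- `υ(W) = loc^⊗(Γ_p | p ∈ W)`. -/
noncomputable def upsilon (hτ : FactorsThroughIdem τ) (hD : IsTD (Locale.PT F))
    (W : Set (Locale.PT F)) : LocalizingIdeal T :=
  LocalizingIdeal.generate (Γ hτ hD '' W)

/-- The local-to-global principle for `τ`: the objects `Γ_p`, for `p` a point of `F`, generate
`T` as a localizing ideal. -/
def LocalToGlobal (hτ : FactorsThroughIdem τ) (hD : IsTD (Locale.PT F)) : Prop :=
  upsilon hτ hD Set.univ = ⊤

/-- `Supp L = {p | Γ_p ⊗ L ≠ 0}`, where `Γ_p ⊗ L ≠ 0` means that `Γ_p ⊗ M ≠ 0` for some object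
`M` of `L`. -/
def supp (hτ : FactorsThroughIdem τ) (hD : IsTD (Locale.PT F)) (L : LocalizingIdeal T) :
    Set (Locale.PT F) :=
  {p | ∃ M : T, L.prop M ∧ ¬ IsZero (Γ hτ hD p ⊗ M)}

/-- The support of an object is the support of the localizing ideal that it generates. -/
def suppObj (hτ : FactorsThroughIdem τ) (hD : IsTD (Locale.PT F)) (M : T) : Set (Locale.PT F) :=
  supp hτ hD (LocalizingIdeal.generate {M})

end Support

end BigTT

namespace BigTT

section Auxiliary

variable {T : Type u} [Category.{v} T] [HasZeroObject T] [HasShift T ℤ] [Preadditive T]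
  [∀ n : ℤ, (shiftFunctor T n).Additive] [Pretriangulated T] [HasCoproducts.{v} T]
  [MonoidalCategory T]

namespace LocalizingIdeal

/-! Two facts carry the proof. First, `isZero_Γ_tensor_Γ`: distinct points have orthogonal
idempotents. Second, `LocalToGlobal.prop_of_forall`: the colon ideal `(L : M)` contains `𝟙` once it
contains every `Γ_p`, so `M ∈ L` can be tested on the objects `Γ_p ⊗ M`. If `Supp L ⊆ W` and `M ∈
L`, then `Γ_p ⊗ M` lies in `υ(W)` for `p ∈ W` and vanishes otherwise, so `M ∈ υ(W)`; conversely,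
orthogonality makes `Γ_p` kill `υ(W)` for `p ∉ W`. Detection of vanishing is the test for the zero
ideal. For the retraction, if `Γ_p ⊗ Γ_p = 0` then every `Γ_q` kills `Γ_p`, so `Γ_p = 0`,
contradicting the injectivity of `τ`. -/

theorem prop_of_iso (L : LocalizingIdeal T) {X Y : T} (e : X ≅ Y) (h : L.prop X) : L.prop Y :=
  haveI := L.isClosedUnderIsomorphisms
  L.prop.prop_of_iso e h

theorem prop_of_isZero (L : LocalizingIdeal T) {X : T} (h : IsZero X) : L.prop X :=
  haveI := L.isTriangulated
  haveI := L.isClosedUnderIsomorphisms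
  L.prop.prop_of_isZero h

theorem subset_generate {𝓜 : Set T} {M : T} (hM : M ∈ 𝓜) : (generate 𝓜).prop M :=
  fun _ hL => hL M hM

theorem generate_le {𝓜 : Set T} {L : LocalizingIdeal T} (h : ∀ M ∈ 𝓜, L.prop M) :
    generate 𝓜 ≤ L :=
  sInf_le h

theorem tensor_mem_left [BraidedCategory T] (L : LocalizingIdeal T) {M : T} (hM : L.prop M)
    (X : T) : L.prop (M ⊗ X) :=
  L.prop_of_iso (β_ X M) (L.tensor_mem X M hM)

variable (T) in
/-- The localizing ideal of zero objects. -/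
def zero [IsTensorTriangulated T] : LocalizingIdeal T where
  prop := fun M => IsZero M
  isTriangulated :=
    { exists_zero := ⟨0, isZero_zero T, isZero_zero T⟩
      isStableUnderShiftBy := fun n => ⟨fun _ hM => (shiftFunctor T n).map_isZero hM⟩
      toIsTriangulatedClosed₂ := ⟨fun D hD h₁ h₃ => ObjectProperty.le_isoClosure _ _ <|
        (Triangle.isZero₂_iff _ hD).2 ⟨IsZero.eq_of_src h₁ _ _, IsZero.eq_of_tgt h₃ _ _⟩⟩ }
  isClosedUnderIsomorphisms := ⟨fun e h => h.of_iso e.symm⟩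
  coproduct_mem := fun X hX => by
    rw [IsZero.iff_id_eq_zero]
    exact Sigma.hom_ext _ _ fun j => (hX j).eq_of_src _ _
  tensor_mem := fun X M hM => by
    obtain ⟨_, _⟩ := IsTensorTriangulated.exact_tensorLeft X
    exact (tensorLeft X).map_isZero hM

/-- The colon ideal `(L : Y)`, consisting of the objects `X` with `X ⊗ Y` in `L`. -/
def colon [IsTensorTriangulated T] (L : LocalizingIdeal T) (Y : T) : LocalizingIdeal T where
  prop := fun X => L.prop (X ⊗ Y)
  isTriangulated := by
    obtain ⟨_, _⟩ := IsTensorTriangulated.exact_tensorRight Y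
    have := L.isTriangulated
    have := L.isClosedUnderIsomorphisms
    exact
      { exists_zero := ⟨0, isZero_zero T,
          L.prop_of_isZero ((tensorRight Y).map_isZero (isZero_zero T))⟩
        isStableUnderShiftBy := fun n => ⟨fun M hM =>
          L.prop_of_iso (((tensorRight Y).commShiftIso n).app M).symm
            (L.prop.le_shift n _ hM)⟩
        toIsTriangulatedClosed₂ := ⟨fun D hD h₁ h₃ => ObjectProperty.le_isoClosure _ _ <|
          L.prop.ext_of_isTriangulatedClosed₂ _ ((tensorRight Y).map_distinguished D hD) h₁ h₃⟩ }
  isClosedUnderIsomorphisms := ⟨fun e h => L.prop_of_iso (whiskerRightIso e Y) h⟩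
  coproduct_mem := fun {J} X hX => by
    have := IsTensorTriangulated.coproducts_tensorRight Y J
    exact L.prop_of_iso (PreservesCoproduct.iso (tensorRight Y) X).symm (L.coproduct_mem _ hX)
  tensor_mem := fun X M hM => L.prop_of_iso (α_ X M Y).symm (L.tensor_mem X _ hM)

end LocalizingIdeal

variable [SymmetricCategory T] [IsTensorTriangulated T]

/-! ### Smashing ideals are generated by their idempotent coalgebras -/

namespace IdempotentAlgebra

theorem exists_triangle_coalgebra (A : IdempotentAlgebra T) :
    ∃ δ : A.obj ⟶ A.coalgebra.obj⟦(1 : ℤ)⟧,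
      Triangle.mk A.coalgebra.counit A.unit δ ∈ distTriang T :=
  A.exists_coalgebra.choose_spec

theorem ideal_prop_coalgebra (A : IdempotentAlgebra T) : A.ideal.prop A.coalgebra.obj := by
  obtain ⟨δ, hD⟩ := A.exists_triangle_coalgebra
  obtain ⟨_, _⟩ := IsTensorTriangulated.exact_tensorLeft A.obj
  exact Triangle.isZero₁_of_isIso₂ _ ((tensorLeft A.obj).map_distinguished _ hD)
    A.isIso_whiskerLeft

/-- When `A ⊗ M = 0`, tensoring the triangle `C ⟶ 𝟙 ⟶ A` with `M` gives `C ⊗ M ≅ M`. -/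
theorem ideal_le_of_prop_coalgebra (A : IdempotentAlgebra T) {L : LocalizingIdeal T}
    (h : L.prop A.coalgebra.obj) : A.ideal ≤ L := by
  intro M hM
  obtain ⟨δ, hD⟩ := A.exists_triangle_coalgebra
  obtain ⟨_, _⟩ := IsTensorTriangulated.exact_tensorRight M
  have : IsIso (A.coalgebra.counit ▷ M) :=
    (Triangle.isZero₃_iff_isIso₁ _ ((tensorRight M).map_distinguished _ hD)).1 hM
  exact L.prop_of_iso (asIso (A.coalgebra.counit ▷ M) ≪≫ λ_ M) (L.tensor_mem_left h M)

end IdempotentAlgebra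

/-- Each `x : X` induces a point of `F`, namely `a ↦ x ∈ e a`, and these points already detect the
order. -/
theorem IsSpatial.le_of_openOf_subset {F : Type w} [Order.Frame F] (hF : IsSpatial F) {f g : F}
    (h : openOf f ⊆ openOf g) : f ≤ g := by
  obtain ⟨X, _, ⟨e⟩⟩ := hF
  rw [← e.le_iff_le]
  intro x hx
  let p : Locale.PT F :=
    { toFun := fun a => x ∈ e a
      map_inf' := fun a b => by simp
      map_top' := by simp
      map_sSup' := fun S => by
        refine propext ?_
        simp only [OrderIso.map_sSup, TopologicalSpace.Opens.mem_iSup, sSup_Prop_eq]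
        constructor
        · rintro ⟨a, ha, hx⟩
          exact ⟨_, ⟨a, ha, rfl⟩, hx⟩
        · rintro ⟨_, ⟨a, ha, rfl⟩, hx⟩
          exact ⟨a, ha, hx⟩ }
  exact h (show p ∈ openOf f from hx)

/-! ### Orthogonality and nonvanishing of the `Γ_p` -/

variable {F : Type w} [Order.Frame F] {τ : FrameHom F (LocalizingIdeal T)}

theorem algebraAt_ideal (hτ : FactorsThroughIdem τ) (f : F) : (algebraAt hτ f).ideal = τ f :=
  (hτ f).choose_spec

theorem prop_coalgebraAt (hτ : FactorsThroughIdem τ) (f : F) :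
    (τ f).prop (coalgebraAt hτ f).obj := by
  rw [← algebraAt_ideal hτ f]
  exact (algebraAt hτ f).ideal_prop_coalgebra

theorem prop_iff_isZero_algebraAt (hτ : FactorsThroughIdem τ) (f : F) (M : T) :
    (τ f).prop M ↔ IsZero ((algebraAt hτ f).obj ⊗ M) := by
  rw [← algebraAt_ideal hτ f]
  rfl

/-- `C_{τ f} ⊗ A_{τ g}` vanishes only if `τ f ≤ τ g`. -/
theorem le_of_isZero_tensor (hτ : FactorsThroughIdem τ) (hinj : Function.Injective τ) {f g : F}
    (h : IsZero ((coalgebraAt hτ f).obj ⊗ (algebraAt hτ g).obj)) : f ≤ g := by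
  have hle : τ f ≤ τ g := by
    rw [← algebraAt_ideal hτ f]
    exact (algebraAt hτ f).ideal_le_of_prop_coalgebra
      ((prop_iff_isZero_algebraAt hτ g _).2 (h.of_iso (β_ _ _)))
  -- An injective map preserving binary meets reflects the order.
  rw [← inf_eq_left]
  exact hinj (by rw [map_inf, inf_eq_left.2 hle])

/-- If `f ⊓ f' ≤ g ⊔ g'` then `C_{τ f} ⊗ A_{τ g}` and `C_{τ f'} ⊗ A_{τ g'}` are orthogonal. -/
theorem isZero_tensor_of_inf_le_sup (hτ : FactorsThroughIdem τ) {f g f' g' : F}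
    (h : f ⊓ f' ≤ g ⊔ g') :
    IsZero (((coalgebraAt hτ f).obj ⊗ (algebraAt hτ g).obj) ⊗
      ((coalgebraAt hτ f').obj ⊗ (algebraAt hτ g').obj)) := by
  let A := (algebraAt hτ g).obj
  let A' := (algebraAt hτ g').obj
  let C := (coalgebraAt hτ f).obj
  let C' := (coalgebraAt hτ f').obj
  -- The annihilator of `A ⊗ A'`. Being a localizing ideal, it contains `τ g ⊔ τ g'` as soon as it
  -- contains both terms.
  let K := (LocalizingIdeal.zero T).colon (A ⊗ A')
  have hg : τ g ≤ K := fun M hM =>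
    ((LocalizingIdeal.zero T).tensor_mem_left ((prop_iff_isZero_algebraAt hτ g M).1 hM) A').of_iso
      ((α_ M A A').symm ≪≫ whiskerRightIso (β_ M A) A')
  have hg' : τ g' ≤ K := fun M hM =>
    ((LocalizingIdeal.zero T).tensor_mem A _ ((prop_iff_isZero_algebraAt hτ g' M).1 hM)).of_iso
      (β_ M (A ⊗ A') ≪≫ α_ A A' M)
  -- Passing through the ideal generated by `C ⊗ C'` lets `le_inf` give membership in the lattice
  -- meet.
  have hC : (τ f ⊓ τ f').prop (C ⊗ C') :=
    (le_inf (LocalizingIdeal.generate_le (𝓜 := {C ⊗ C'}) fun M hM => by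
        obtain rfl := hM
        exact (τ f).tensor_mem_left (prop_coalgebraAt hτ f) _)
      (LocalizingIdeal.generate_le fun M hM => by
        obtain rfl := hM
        exact (τ f').tensor_mem _ _ (prop_coalgebraAt hτ f'))) _
      (LocalizingIdeal.subset_generate rfl)
  have hle : τ f ⊓ τ f' ≤ K := by
    rw [← map_inf]
    refine (OrderHomClass.mono τ h).trans ?_
    rw [map_sup]
    exact sup_le hg hg'
  have hK : IsZero ((C ⊗ C') ⊗ (A ⊗ A')) := hle _ hC
  exact hK.of_iso (α_ C A (C' ⊗ A') ≪≫ whiskerLeftIso C ((α_ A C' A').symm ≪≫ whiskerRightIso (β_ A C') A' ≪≫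
      α_ C' A A') ≪≫ (α_ C C' (A ⊗ A')).symm)

/-- A point lying in both `U_f` and `U_f'` but in neither `U_g` nor `U_g'` would equal both `p` and
`q`. -/
theorem isZero_Γ_tensor_Γ (hF : IsSpatial F) (hτ : FactorsThroughIdem τ)
    (hD : IsTD (Locale.PT F)) {p q : Locale.PT F} (hpq : p ≠ q) :
    IsZero (Γ hτ hD p ⊗ Γ hτ hD q) := by
  refine isZero_tensor_of_inf_le_sup hτ (hF.le_of_openOf_subset fun r hr => ?_)
  have hp := (exists_presentation hD p).choose_spec
  have hq := (exists_presentation hD q).choose_spec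
  generalize (exists_presentation hD p).choose = a at hr hp ⊢
  generalize (exists_presentation hD q).choose = b at hr hq ⊢
  have hr' : r a.1 ∧ r b.1 := by simpa [openOf, map_inf] using hr
  have goal : r a.2 ∨ r b.2 := by
    by_contra! hn
    have hrp : r ∈ ({p} : Set (Locale.PT F)) := hp ▸ ⟨hr'.1, hn.1⟩
    have hrq : r ∈ ({q} : Set (Locale.PT F)) := hq ▸ ⟨hr'.2, hn.2⟩
    exact hpq (hrp.symm.trans hrq)
  simpa [openOf, map_sup] using goal

theorem not_isZero_Γ (hinj : Function.Injective τ) (hτ : FactorsThroughIdem τ)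
    (hD : IsTD (Locale.PT F)) (p : Locale.PT F) : ¬ IsZero (Γ hτ hD p) := fun h => by
  have hle := le_of_isZero_tensor hτ hinj h
  have hp := (exists_presentation hD p).choose_spec.subset rfl
  exact hp.2 (OrderHomClass.mono p hle hp.1)

/-! ### Consequences of the local-to-global principle -/

/-- Under the local-to-global principle, membership in a localizing ideal can be tested after
tensoring with all the `Γ_p`. -/
theorem LocalToGlobal.prop_of_forall {hτ : FactorsThroughIdem τ} {hD : IsTD (Locale.PT F)}
    (hltg : LocalToGlobal hτ hD) {L : LocalizingIdeal T} {M : T}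
    (h : ∀ p, L.prop (Γ hτ hD p ⊗ M)) : L.prop M := by
  have hle : upsilon hτ hD Set.univ ≤ L.colon M := LocalizingIdeal.generate_le <| by
    rintro _ ⟨p, -, rfl⟩
    exact h p
  rw [hltg] at hle
  have htop : LocalizingIdeal.generate {𝟙_ T} ≤ (⊤ : LocalizingIdeal T) := le_top
  exact L.prop_of_iso (λ_ M) ((htop.trans hle) _ (LocalizingIdeal.subset_generate rfl))

theorem gc_supp_upsilon (hF : IsSpatial F) {hτ : FactorsThroughIdem τ}
    {hD : IsTD (Locale.PT F)} (hltg : LocalToGlobal hτ hD) :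
    GaloisConnection (supp hτ hD) (upsilon hτ hD) := by
  intro L W
  constructor
  · intro h M hM
    refine hltg.prop_of_forall fun p => ?_
    by_cases hp : p ∈ W
    · exact LocalizingIdeal.tensor_mem_left _
        (LocalizingIdeal.subset_generate (Set.mem_image_of_mem _ hp)) M
    · by_contra hn
      exact hp (h ⟨M, hM, fun hz => hn (LocalizingIdeal.prop_of_isZero _ hz)⟩)
  · rintro h p ⟨M, hM, hne⟩
    by_contra hp
    -- The annihilator of `Γ_p` contains every generator of `υ(W)` when `p ∉ W`.
    have hle : upsilon hτ hD W ≤ (LocalizingIdeal.zero T).colon (Γ hτ hD p) :=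
      LocalizingIdeal.generate_le <| by
        rintro _ ⟨q, hq, rfl⟩
        exact isZero_Γ_tensor_Γ hF hτ hD fun hqp => hp (hqp ▸ hq)
    exact hne (IsZero.of_iso (hle M (h M hM)) (β_ _ _))

theorem isZero_iff_suppObj_eq_empty {hτ : FactorsThroughIdem τ} {hD : IsTD (Locale.PT F)}
    (hltg : LocalToGlobal hτ hD) (M : T) : IsZero M ↔ suppObj hτ hD M = ∅ := by
  rw [Set.eq_empty_iff_forall_notMem]
  constructor
  · rintro hM p ⟨N, hN, hne⟩
    have hle : LocalizingIdeal.generate {M} ≤ LocalizingIdeal.zero T :=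
      LocalizingIdeal.generate_le <| by
        rintro _ rfl
        exact hM
    exact hne ((LocalizingIdeal.zero T).tensor_mem _ _ (hle N hN))
  · intro h
    refine hltg.prop_of_forall (L := LocalizingIdeal.zero T) fun p => ?_
    by_contra hn
    exact h p ⟨M, LocalizingIdeal.subset_generate rfl, hn⟩

theorem supp_upsilon (hF : IsSpatial F) (hinj : Function.Injective τ)
    {hτ : FactorsThroughIdem τ} {hD : IsTD (Locale.PT F)} (hltg : LocalToGlobal hτ hD)
    (W : Set (Locale.PT F)) : supp hτ hD (upsilon hτ hD W) = W := by
  refine Set.Subset.antisymm ((gc_supp_upsilon hF hltg).l_u_le W) fun p hp => ?_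
  refine ⟨Γ hτ hD p, LocalizingIdeal.subset_generate (Set.mem_image_of_mem _ hp), fun hz => ?_⟩
  -- It suffices that each `Γ_q` kills `Γ_p`: the case `q = p` is `hz`, the others are
  -- orthogonality.
  refine not_isZero_Γ hinj hτ hD p
    (hltg.prop_of_forall (L := LocalizingIdeal.zero T) fun q => ?_)
  obtain rfl | hqp := eq_or_ne q p
  · exact hz
  · exact isZero_Γ_tensor_Γ hF hτ hD hqp

end Auxiliary

end BigTT

theorem mainTheorem7 {T : Type u} [Category.{v} T] [HasZeroObject T] [HasShift T ℤ]
    [Preadditive T] [∀ n : ℤ, (shiftFunctor T n).Additive] [Pretriangulated T] [IsTriangulated T]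
    [HasCoproducts.{v} T] [MonoidalCategory T] [SymmetricCategory T] [MonoidalClosed T]
    [BigTT.IsBigTTCategory T]
    {F : Type w} [Order.Frame F] (hF : BigTT.IsSpatial F)
    (τ : FrameHom F (BigTT.LocalizingIdeal T)) (hinj : Function.Injective τ)
    (hτ : BigTT.FactorsThroughIdem τ)
    (hD : BigTT.IsTD (Locale.PT F)) (hltg : BigTT.LocalToGlobal hτ hD) :
    GaloisConnection (BigTT.supp hτ hD) (BigTT.upsilon hτ hD) ∧
      (∀ M : T, IsZero M ↔ BigTT.suppObj hτ hD M = ∅) ∧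
      ∀ W : Set (Locale.PT F), BigTT.supp hτ hD (BigTT.upsilon hτ hD W) = W := by
  exact ⟨BigTT.gc_supp_upsilon hF hltg, BigTT.isZero_iff_suppObj_eq_empty hltg,
    BigTT.supp_upsilon hF hinj hltg⟩
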